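/- Let $\mathcal T_*$ be the category of pointed connected compactly generated spaces and base-point preserving continuous maps, and $\operatorname{ho}\mathcal T_*$ the category with the same objects whose morphisms are pointed homotopy classes $[f]$ of maps. A *lattice* is a non-unital category $\Gamma$ with finitely many objects and arrows, no arrow from an object to itself, two objects $v_{\rm init}, v_{\rm fin}$ such that every object $w\ne v_{\rm init}$ receives an arrow from $v_{\rm init}$ and every object $w\neq v_{\rm fin}$ has an arrow to $v_{\rm fin}$, exactly one arrow $\phi_{\max}\colon v_{\rm init}\to v_{\rm fin}$, and at least one object different from $v_{\rm init}$ and $v_{\rm fin}$. The category $W\Gamma$ has the objects of $\Gamma$, and $W\Gamma(u,v)$ is the quotient space of $\bigsqcup_{n\ge 0}\Gamma_{n+1}(u,v)\times[0,1]^n$, where $\Gamma_{n+1}(u,v)$ is the discrete set of chains $u\xrightarrow{f_{n+1}}v_n\to\cdots\to v_1\xrightarrow{f_1}v$ in $\Gamma$; a point is written $f_1\circ_{t_1}f_2\circ_{t_2}\cdots\circ_{t_n}f_{n+1}$, and whenever $t_i=0$ it is identified with the point in which $f_i\circ_{0}f_{i+1}$ is replaced by the composite $f_if_{i+1}$. Composition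 in $W\Gamma$ is concatenation with parameter $1$: $(p,q)\mapsto p\circ_1 q$. An arrow $f$ of $\Gamma$ is identified with the point $f$ of $W\Gamma$ given by the $1$-chain $f$. The subcategory $bW\Gamma\subset W\Gamma$ has all objects, $bW\Gamma(u,v)=W\Gamma(u,v)$ for $(u,v)\ne(v_{\rm init},v_{\rm fin})$, and $bW\Gamma(v_{\rm init},v_{\rm fin})$ consists of the composites $\alpha\circ\beta$ with $\beta\in W\Gamma(v_{\rm init},w)$, $\alpha\in W\Gamma(w,v_{\rm fin})$, $v_{\rm init}\ne w\ne v_{\rm fin}$. Its $0$-skeleton $\operatorname{sk}_0 bW\Gamma$ is the subcategory generated by the vertices (points with all $t_i\in\{0,1\}$) that lie in $bW\Gamma$. A functor $F$ from a subcategory $U$ of $W\Gamma$ to $\mathcal T_*$ is always meant to be continuous: it preserves composition, and the maps $U(u,v)\times F(u)\to F(v)$ are continuous. Let $\Gamma$ be a lattice and $\mathcal A\colon\Gamma\to\operatorname{ho}\mathcal T_*$ a functor. A *$0$-realization* of $\mathcal A$ is a functor $\bar{\mathcal A}_0\colon\operatorname{sk}_0 bW\Gamma\to\mathcal T_*$ with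 $\bar{\mathcal A}_0(v)=\mathcal A(v)$ for every object $v$ and $[\bar{\mathcal A}_0(f)]=\mathcal A(f)$ for every arrow $f\neq\phi_{\max}$ of $\Gamma$. **Proposition.** Suppose that some $0$-realization $\bar{\mathcal A}_0\colon\operatorname{sk}_0 bW\Gamma\to\mathcal T_*$ of $\mathcal A$ extends to a functor $\mathcal B\colon W\Gamma\to\mathcal T_*$. Then every $0$-realization $\bar{\mathcal A}_0'$ of $\mathcal A$ extends to some functor $\mathcal B'\colon W\Gamma\to\mathcal T_*$. -/

import Mathlib

universe u v w

namespace HigherOps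

open scoped unitInterval

/-! ### Pointed spaces and their homotopy category -/

/-- A pointed connected compactly generated space (an object of `𝒯_*`). -/
structure PtSpace where
  carrier : Type w
  [top : TopologicalSpace carrier]
  [compactlyGenerated : CompactlyGeneratedSpace carrier]
  [connected : ConnectedSpace carrier]
  base : carrier

instance : CoeSort PtSpace.{w} (Type w) := ⟨PtSpace.carrier⟩

attribute [instance] PtSpace.top PtSpace.compactlyGenerated PtSpace.connected

/-- A morphism of `𝒯_*`: a continuous map that preserves the base point. -/
@[ext]
structure PtMap (X Y : PtSpace.{w}) where
  toMap : C(X, Y)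
  map_base : toMap X.base = Y.base

/-- Composition in `𝒯_*`. -/
def PtMap.comp {X Y Z : PtSpace.{w}} (g : PtMap Y Z) (f : PtMap X Y) : PtMap X Z where
  toMap := g.toMap.comp f.toMap
  map_base := by simp [f.map_base, g.map_base]

/-- Two pointed maps are homotopic if there is a homotopy between them that fixes the base point. -/
def PtMap.setoid (X Y : PtSpace.{w}) : Setoid (PtMap X Y) where
  r f g := ContinuousMap.HomotopicRel f.toMap g.toMap {X.base}
  iseqv := ⟨fun f => .refl f.toMap, fun h => h.symm, fun h k => h.trans k⟩

/-- The morphisms `X ⟶ Y` of `ho 𝒯_*`: pointed homotopy classes of pointed maps. The objects of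
`ho 𝒯_*` are those of `𝒯_*`. -/
def HoMap (X Y : PtSpace.{w}) : Type w := Quotient (PtMap.setoid X Y)

/-- The homotopy class of a pointed map. -/
def PtMap.cls {X Y : PtSpace.{w}} (f : PtMap X Y) : HoMap X Y := Quotient.mk _ f

/-- Composition in `ho 𝒯_*`. -/
def HoMap.comp {X Y Z : PtSpace.{w}} (g : HoMap Y Z) (f : HoMap X Y) : HoMap X Z :=
  Quotient.map₂ PtMap.comp (by
    rintro g g' ⟨G⟩ f f' ⟨F⟩
    refine ⟨⟨G.toHomotopy.comp F.toHomotopy, ?_⟩⟩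
    rintro t x rfl
    have h1 := F.eq_fst t (Set.mem_singleton X.base)
    have h2 := G.eq_fst t (Set.mem_singleton Y.base)
    change G (t, F (t, X.base)) = g.toMap (f.toMap X.base)
    rw [h1, f.map_base, h2]) g f

/-! ### Lattices -/

/-- A lattice on the set of nodes `V`: a finite directed category, treated as a nonunital category
(so there is no arrow from a node to itself), with a weakly initial node `init`, a weakly terminal
node `fin`, exactly one arrow from `init` to `fin`, and at least one further node. -/
structure DiagramLattice (V : Type u) where
  Hom : V → V → Type v
  comp : ∀ {a b c : V}, Hom b c → Hom a b → Hom a c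
  assoc : ∀ {a b c d : V} (h : Hom c d) (g : Hom b c) (f : Hom a b),
    comp (comp h g) f = comp h (comp g f)
  finite_nodes : Finite V
  finite_hom : ∀ a b : V, Finite (Hom a b)
  directed : ∀ a : V, IsEmpty (Hom a a)
  init : V
  fin : V
  weak_init : ∀ a : V, a ≠ init → Nonempty (Hom init a)
  weak_fin : ∀ a : V, a ≠ fin → Nonempty (Hom a fin)
  /-- the maximal arrow -/
  maxArrow : Hom init fin
  eq_maxArrow : ∀ f : Hom init fin, f = maxArrow
  nontrivial : ∃ a : V, a ≠ init ∧ a ≠ fin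

variable {V : Type u}

/-- Initial data: a functor from the lattice `Γ` to `ho 𝒯_*`. -/
structure InitialData (Γ : DiagramLattice.{u, v} V) where
  obj : V → PtSpace.{w}
  map : ∀ {a b : V}, Γ.Hom a b → HoMap (obj a) (obj b)
  map_comp : ∀ {a b c : V} (g : Γ.Hom b c) (f : Γ.Hom a b), map (Γ.comp g f) = (map g).comp (map f)

/-! ### The `W`-construction -/

/-- Nonempty chains of composable arrows of `Γ`; `cons f c` is the chain `c` followed by `f`. -/
inductive Chain (Γ : DiagramLattice.{u, v} V) : V → V → Type (max u v)
  | single {a b : V} (f : Γ.Hom a b) : Chain Γ a b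
  | cons {a b c : V} (f : Γ.Hom b c) (l : Chain Γ a b) : Chain Γ a c

/-- The number of internal nodes of a chain (`n` for an `(n+1)`-chain). -/
def Chain.inner {Γ : DiagramLattice.{u, v} V} {a b : V} : Chain Γ a b → ℕ
  | .single _ => 0
  | .cons _ l => l.inner + 1

/-- The disjoint union, over all chains `c` from `a` to `b`, of the cubes `Iⁿ`, where `n` is the
number of internal nodes of `c`. A point is written `f₁ ∘_{t₁} f₂ ∘_{t₂} ⋯ ∘_{tₙ} fₙ₊₁`, where
`f₁` is the last arrow of the chain. It carries the disjoint union topology. -/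
abbrev Pre (Γ : DiagramLattice.{u, v} V) (a b : V) : Type (max u v) :=
  Σ c : Chain Γ a b, (Fin c.inner → I)

/-- The point `f` of the zero-dimensional cube of the `1`-chain `f`. -/
def Pre.of {Γ : DiagramLattice.{u, v} V} {a b : V} (f : Γ.Hom a b) : Pre Γ a b :=
  ⟨.single f, Fin.elim0⟩

/-- The point `f ∘_t p`. -/
def Pre.cons {Γ : DiagramLattice.{u, v} V} {a b c : V} (f : Γ.Hom b c) (t : I) (p : Pre Γ a b) :
    Pre Γ a c :=
  ⟨.cons f p.1, Fin.cons t p.2⟩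

/-- The relation that replaces one occurrence of `f ∘_0 g` in a point by the composite `f g`. -/
inductive Face (Γ : DiagramLattice.{u, v} V) : ∀ {a b : V}, Pre Γ a b → Pre Γ a b → Prop
  | last {a b c : V} (f : Γ.Hom b c) (g : Γ.Hom a b) :
      Face Γ (Pre.cons f 0 (Pre.of g)) (Pre.of (Γ.comp f g))
  | head {a b c d : V} (f : Γ.Hom c d) (g : Γ.Hom b c) (t : I) (p : Pre Γ a b) :
      Face Γ (Pre.cons f 0 (Pre.cons g t p)) (Pre.cons (Γ.comp f g) t p)
  | tail {a b c : V} (f : Γ.Hom b c) (t : I) {p q : Pre Γ a b} :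
      Face Γ p q → Face Γ (Pre.cons f t p) (Pre.cons f t q)

/-- The space of morphisms `WΓ(a, b)`: the quotient of the disjoint union of cubes by the
equivalence relation generated by `Face`, with the quotient topology. -/
def W (Γ : DiagramLattice.{u, v} V) (a b : V) : Type (max u v) :=
  Quot (@Face V Γ a b)

instance (Γ : DiagramLattice.{u, v} V) (a b : V) : TopologicalSpace (W Γ a b) :=
  inferInstanceAs (TopologicalSpace (Quot (@Face V Γ a b)))

/-- The class of a point in `WΓ(a, b)`. -/
def W.mk {Γ : DiagramLattice.{u, v} V} {a b : V} (p : Pre Γ a b) : W Γ a b := Quot.mk _ p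

/-- The inclusion `σ` of the arrows of `Γ` into those of `WΓ`. -/
def W.ofArrow {Γ : DiagramLattice.{u, v} V} {a b : V} (f : Γ.Hom a b) : W Γ a b := W.mk (Pre.of f)

/-- Auxiliary recursion for `Pre.append`. -/
def Pre.appendAux {Γ : DiagramLattice.{u, v} V} {a b c : V} (q : Pre Γ a b) :
    (l : Chain Γ b c) → (Fin l.inner → I) → Pre Γ a c
  | .single f, _ => Pre.cons f 1 q
  | .cons f l, t => Pre.cons f (t (0 : Fin (l.inner + 1)))
      (Pre.appendAux q l (Fin.tail (n := l.inner) t))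

/-- Concatenation `p ∘_1 q`. -/
def Pre.append {Γ : DiagramLattice.{u, v} V} {a b c : V} (p : Pre Γ b c) (q : Pre Γ a b) :
    Pre Γ a c :=
  Pre.appendAux q p.1 p.2

section
variable {Γ : DiagramLattice.{u, v} V}

theorem Pre.of_append {a b c : V} (f : Γ.Hom b c) (q : Pre Γ a b) :
    (Pre.of f).append q = Pre.cons f 1 q := rfl

theorem Pre.cons_append {a b c d : V} (f : Γ.Hom c d) (t : I) (p : Pre Γ b c) (q : Pre Γ a b) :
    (Pre.cons f t p).append q = Pre.cons f t (p.append q) := rfl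

theorem Pre.rec_on {motive : ∀ {a b : V}, Pre Γ a b → Prop}
    (of : ∀ {a b : V} (f : Γ.Hom a b), motive (Pre.of f))
    (cons : ∀ {a b c : V} (f : Γ.Hom b c) (t : I) (p : Pre Γ a b), motive p →
      motive (Pre.cons f t p)) {a b : V} (p : Pre Γ a b) : motive p := by
  obtain ⟨l, t⟩ := p
  induction l with
  | single f =>
    have e : t = Fin.elim0 := funext fun i => Fin.elim0 i
    rw [e]
    exact of f
  | cons f l ih =>
    change Fin (l.inner + 1) → I at t
    have e : Pre.cons f (t 0) ⟨l, Fin.tail t⟩ = ⟨.cons f l, t⟩ :=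
      congrArg (Sigma.mk (Chain.cons f l)) (Fin.cons_self_tail t)
    exact e ▸ cons f (t 0) ⟨l, Fin.tail t⟩ (ih _)

theorem Face.append_left {a b c : V} {p p' : Pre Γ b c} (h : Face Γ p p') (q : Pre Γ a b) :
    Face Γ (p.append q) (p'.append q) := by
  induction h with
  | last f g => exact .head f g 1 q
  | head f g t p => exact .head f g t (p.append q)
  | tail f t _ ih => exact .tail f t ih

theorem Face.append_right {a b c : V} (p : Pre Γ b c) {q q' : Pre Γ a b} (h : Face Γ q q') :
    Face Γ (p.append q) (p.append q') := by
  induction p using Pre.rec_on with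
  | of f => exact .tail f 1 h
  | cons f t p ih => exact .tail f t (ih h)

end

/-- Composition in `WΓ`, given by concatenation. -/
def W.comp {Γ : DiagramLattice.{u, v} V} {a b c : V} (x : W Γ b c) (y : W Γ a b) : W Γ a c :=
  Quot.map₂ Pre.append (fun p _ _ h => h.append_right p) (fun _ _ q h => h.append_left q) x y

theorem W.assoc {Γ : DiagramLattice.{u, v} V} {a b c d : V} (x : W Γ c d) (y : W Γ b c)
    (z : W Γ a b) : (x.comp y).comp z = x.comp (y.comp z) := by
  induction x using Quot.ind with | _ p
  induction y using Quot.ind with | _ q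
  induction z using Quot.ind with | _ r
  refine congrArg (Quot.mk _) ?_
  induction p using Pre.rec_on with
  | of f => rfl
  | cons f t p ih => exact congrArg (Pre.cons f t) (ih q)

/-! ### Subcategories of `WΓ` -/

/-- A (nonunital) subcategory of `WΓ` with all the nodes as objects. -/
structure Subcat (Γ : DiagramLattice.{u, v} V) where
  mor : ∀ a b : V, Set (W Γ a b)
  comp_mem : ∀ {a b c : V} {x : W Γ b c} {y : W Γ a b},
    x ∈ mor b c → y ∈ mor a b → x.comp y ∈ mor a c

/-- `WΓ` itself. -/
def Subcat.whole (Γ : DiagramLattice.{u, v} V) : Subcat Γ where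
  mor _ _ := Set.univ
  comp_mem _ _ := trivial

theorem Chain.ne {Γ : DiagramLattice.{u, v} V} {a b : V} (l : Chain Γ a b) : a ≠ b := by
  have h : Nonempty (Γ.Hom a b) := by
    induction l with
    | single f => exact ⟨f⟩
    | cons f _ ih => exact ⟨Γ.comp f ih.some⟩
  rintro rfl
  exact (Γ.directed a).false h.some

theorem W.ne {Γ : DiagramLattice.{u, v} V} {a b : V} (x : W Γ a b) : a ≠ b := by
  induction x using Quot.ind with | _ p
  exact p.1.ne

/-- The subcategory `bWΓ`: all morphisms of `WΓ`, except that from `init` to `fin` only those are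
kept that decompose through some other node. -/
def Subcat.basis (Γ : DiagramLattice.{u, v} V) : Subcat Γ where
  mor a b := {x | a = Γ.init → b = Γ.fin →
    ∃ (c : V) (y : W Γ c b) (z : W Γ a c), c ≠ Γ.init ∧ c ≠ Γ.fin ∧ x = y.comp z}
  comp_mem {a c b x y} _ _ := by
    intro ha hb
    exact ⟨c, x, y, fun h => y.ne (ha.trans h.symm), fun h => x.ne (h.trans hb.symm), rfl⟩

/-- The face of the cube `C[c]` in which the coordinates in `S` are free and every other coordinate
`i` has the fixed value `e i`. -/
def face {Γ : DiagramLattice.{u, v} V} {a b : V} (c : Chain Γ a b) (S : Finset (Fin c.inner))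
    (e : Fin c.inner → I) : Set (W Γ a b) :=
  {x | ∃ t : Fin c.inner → I, (∀ i ∉ S, t i = e i) ∧ x = W.mk ⟨c, t⟩}

/-- Membership in the subcategory generated by all those faces of dimension at most `k` of cubes
of `WΓ` that lie in `U`. -/
inductive SkMem {Γ : DiagramLattice.{u, v} V} (k : ℕ) (U : Subcat Γ) :
    ∀ {a b : V}, W Γ a b → Prop
  | face {a b : V} (c : Chain Γ a b) (S : Finset (Fin c.inner)) (e : Fin c.inner → I)
      (he : ∀ i ∉ S, e i = 0 ∨ e i = 1) (hS : S.card ≤ k) (hU : face c S e ⊆ U.mor a b)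
      (x : W Γ a b) (hx : x ∈ face c S e) : SkMem k U x
  | comp {a b c : V} (x : W Γ b c) (y : W Γ a b) :
      SkMem k U x → SkMem k U y → SkMem k U (x.comp y)

/-- The `k`-skeleton of a cubical subcategory `U` of `WΓ`. -/
def Subcat.sk {Γ : DiagramLattice.{u, v} V} (k : ℕ) (U : Subcat Γ) : Subcat Γ where
  mor _ _ := {x | SkMem k U x}
  comp_mem hx hy := .comp _ _ hx hy

/-- Every arrow of `Γ` other than the maximal one belongs to every skeleton of `bWΓ`. -/
theorem ofArrow_mem_sk_basis {Γ : DiagramLattice.{u, v} V} (k : ℕ) {a b : V} (f : Γ.Hom a b)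
    (h : ¬(a = Γ.init ∧ b = Γ.fin)) : W.ofArrow f ∈ ((Subcat.basis Γ).sk k).mor a b :=
  SkMem.face (U := Subcat.basis Γ) (.single f) ∅ Fin.elim0 (fun i => i.elim0) (Nat.zero_le k)
    (by intro x _ ha hb; exact absurd ⟨ha, hb⟩ h) _ ⟨Fin.elim0, fun i => i.elim0, rfl⟩

/-! ### Functors to spaces and realizations -/

/-- A continuous functor `U → 𝒯_*` which on objects is the given family `X`. Continuity of
`U(a, b) → 𝒯_*(X a, X b)` is expressed through the adjoint map `U(a, b) × X a → X b`. -/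
structure SpaceFunctor {Γ : DiagramLattice.{u, v} V} (U : Subcat Γ) (X : V → PtSpace.{w}) where
  map : ∀ {a b : V}, U.mor a b → PtMap (X a) (X b)
  map_comp : ∀ {a b c : V} (x : U.mor b c) (y : U.mor a b),
    map ⟨x.1.comp y.1, U.comp_mem x.2 y.2⟩ = (map x).comp (map y)
  continuous_map : ∀ a b : V, Continuous fun p : U.mor a b × X a => (map p.1).toMap p.2

/-- `F` is an `n`-realization of the initial data `A`: a functor `sk_n bWΓ → 𝒯_*` with the same
objects as `A`, such that `[F(f)] = A(f)` for every arrow `f` of `Γ` except the maximal one, which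
is the only arrow from `init` to `fin`. -/
def IsRealization {Γ : DiagramLattice.{u, v} V} (n : ℕ) (A : InitialData.{u, v, w} Γ)
    (F : SpaceFunctor ((Subcat.basis Γ).sk n) A.obj) : Prop :=
  ∀ (a b : V) (f : Γ.Hom a b) (h : ¬(a = Γ.init ∧ b = Γ.fin)),
    (F.map ⟨W.ofArrow f, ofArrow_mem_sk_basis n f h⟩).cls = A.map f

/-- The functor `B : WΓ → 𝒯_*` extends the functor `F : U → 𝒯_*`. -/
def Extends {Γ : DiagramLattice.{u, v} V} {U : Subcat Γ} {X : V → PtSpace.{w}}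
    (B : SpaceFunctor (Subcat.whole Γ) X) (F : SpaceFunctor U X) : Prop :=
  ∀ (a b : V) (x : U.mor a b), B.map ⟨x.1, trivial⟩ = F.map x

end HigherOps

/-! Both `0`-realizations represent `A`, so for each arrow `f` other than the maximal one the maps
`B(f)` and `F'(f)` are joined by a pointed homotopy `H_f`; for the maximal arrow the constant
homotopy serves. The task is to deform `B` into a functor on all of `WΓ` with value `H_f(1, -)` at
`f`. This suffices: the vertices of `bWΓ` are generated under composition by the non-maximal arrows
(`extends_of_ofArrow`).

The room for the homotopies comes from the cube parameters. A point is cut wherever a parameter `s`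
is at least `2/3`, and each side of the cut receives the end defect `1 - s`; the outer ends have
defect `0`. A resulting segment has total defect `μ`, the maximum of its parameters and its two end
defects. If `μ ≥ 1/3`, it is sent to `B` of the segment with parameters stretched so that `[0, 1/3]`
becomes `0` and `[2/3, 1]` becomes `1`. If `μ < 1/3`, it is sent to the homotopy of its total
composite at time `1 - 3μ`. The point goes to the composite of its segments.

Continuity is checked on two walls. At `μ = 1/3` all parameters stretch to `0`, and both recipes
give `B` of the total composite (`continuous_segment`). At `s = 2/3` every segment concerned has `μ
≥ 1/3`, and `B` of the stretched points is multiplicative there because `s` stretches to `1`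
(`glued_glue`, `continuous_glued`). At `s = 1` a cut has defect `0`, like an outer end, which gives
functoriality (`value_append`). An erased parameter `0` changes neither the cuts, nor `μ`, nor the
total composite (`value_congr`).

Since `X a` need not be locally compact, continuity on `W Γ a b × X a` rests on the projection from
the cubes being proper (`W.isProperMap_mk`). -/

namespace HigherOps

open scoped unitInterval

variable {V : Type u} {Γ : DiagramLattice.{u, v} V}

/-! ### Continuity on disjoint unions of cubes -/

theorem continuous_sigma_prod {ι : Type*} {E : ι → Type*} [∀ i, TopologicalSpace (E i)]
    {Y Z : Type*} [TopologicalSpace Y] [TopologicalSpace Z] {f : (Σ i, E i) × Y → Z}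
    (h : ∀ i, Continuous fun q : E i × Y => f (⟨i, q.1⟩, q.2)) : Continuous f := by
  have e : Continuous (f ∘ (Homeomorph.sigmaProdDistrib (X := E) (Y := Y)).symm) :=
    continuous_sigma fun i => h i
  simpa [Function.comp_assoc] using e.comp (Homeomorph.sigmaProdDistrib (X := E) (Y := Y)).continuous

theorem Pre.continuous_mk {a b : V} (l : Chain Γ a b) :
    Continuous fun t : Fin l.inner → I => (⟨l, t⟩ : Pre Γ a b) :=
  @continuous_sigmaMk _ (fun l : Chain Γ a b => Fin l.inner → I) _ l

theorem Pre.continuous_cons {a b c : V} (f : Γ.Hom b c) :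
    Continuous fun q : I × Pre Γ a b => Pre.cons f q.1 q.2 := by
  have : Continuous fun q : Pre Γ a b × I => Pre.cons f q.2 q.1 :=
    continuous_sigma_prod fun l =>
      (Pre.continuous_mk (.cons f l)).comp
        (Continuous.finCons (A := fun _ => I) continuous_snd continuous_fst)
  exact this.comp continuous_swap

/-! ### Gluing, total composite, largest parameter and stretching -/

/-- Auxiliary recursion for `Pre.glue`. -/
def Pre.glueAux {a b c : V} (s : I) (q : Pre Γ a b) :
    (l : Chain Γ b c) → (Fin l.inner → I) → Pre Γ a c
  | .single f, _ => Pre.cons f s q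
  | .cons f l, t => Pre.cons f (t (0 : Fin (l.inner + 1)))
      (Pre.glueAux s q l (Fin.tail (n := l.inner) t))

/-- The concatenation `p ∘_s q`. -/
def Pre.glue {a b c : V} (p : Pre Γ b c) (s : I) (q : Pre Γ a b) : Pre Γ a c :=
  Pre.glueAux s q p.1 p.2

theorem Pre.of_glue {a b c : V} (f : Γ.Hom b c) (s : I) (q : Pre Γ a b) :
    (Pre.of f).glue s q = Pre.cons f s q := rfl

theorem Pre.cons_glue {a b c d : V} (f : Γ.Hom c d) (t : I) (p : Pre Γ b c) (s : I)
    (q : Pre Γ a b) : (Pre.cons f t p).glue s q = Pre.cons f t (p.glue s q) := rfl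

theorem Pre.glue_one {a b c : V} (p : Pre Γ b c) (q : Pre Γ a b) : p.glue 1 q = p.append q := by
  induction p using Pre.rec_on with
  | of f => rfl
  | cons f t p ih => exact congrArg (Pre.cons f t) (ih q)

theorem Pre.glue_assoc {a b c d : V} (p : Pre Γ c d) (s : I) (q : Pre Γ b c) (t : I)
    (r : Pre Γ a b) : (p.glue s q).glue t r = p.glue s (q.glue t r) := by
  induction p using Pre.rec_on with
  | of f => rfl
  | cons f t' p ih => exact congrArg (Pre.cons f t') (ih q)

/-- One arrow on the right is enough: the recursion `glued` enlarges its current segment by a single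
arrow at a time. -/
theorem Pre.continuous_glue_of {a b c : V} (g : Γ.Hom a b) :
    Continuous fun q : Pre Γ b c × I => q.1.glue q.2 (Pre.of g) := by
  refine continuous_sigma_prod fun l => ?_
  induction l with
  | single f => exact (Pre.continuous_cons f).comp (continuous_snd.prodMk continuous_const)
  | cons f l ih =>
    have h0 : Continuous fun q : (Fin (l.inner + 1) → I) × I => q.1 0 :=
      (continuous_apply 0).comp continuous_fst
    have h1 : Continuous fun q : (Fin (l.inner + 1) → I) × I => (Fin.tail q.1, q.2) :=
      (continuous_pi fun i => (continuous_apply i.succ).comp continuous_fst).prodMk continuous_snd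
    exact (Pre.continuous_cons f).comp (h0.prodMk (ih.comp h1))

/-- The composite in `Γ` of all the arrows of a chain. -/
def Chain.total {a b : V} : Chain Γ a b → Γ.Hom a b
  | .single f => f
  | .cons f l => Γ.comp f l.total

theorem Face.total_eq {a b : V} {p q : Pre Γ a b} (h : Face Γ p q) : p.1.total = q.1.total := by
  induction h with
  | last f g => rfl
  | head f g t p => exact (Γ.assoc f g p.1.total).symm
  | tail f t _ ih => exact congrArg (Γ.comp f) ih

/-- Auxiliary recursion for `Pre.maxParam`. -/
def Chain.maxParam {a b : V} : (l : Chain Γ a b) → (Fin l.inner → I) → I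
  | .single _, _ => 0
  | .cons _ l, t => t (0 : Fin (l.inner + 1)) ⊔ l.maxParam (Fin.tail (n := l.inner) t)

/-- The largest parameter of a point, and `0` for an arrow. -/
def Pre.maxParam {a b : V} (p : Pre Γ a b) : I := p.1.maxParam p.2

theorem Pre.maxParam_of {a b : V} (f : Γ.Hom a b) : (Pre.of f).maxParam = 0 := rfl

theorem Pre.maxParam_cons {a b c : V} (f : Γ.Hom b c) (t : I) (p : Pre Γ a b) :
    (Pre.cons f t p).maxParam = t ⊔ p.maxParam := rfl

theorem Pre.maxParam_glue {a b c : V} (p : Pre Γ b c) (s : I) (q : Pre Γ a b) :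
    (p.glue s q).maxParam = p.maxParam ⊔ (s ⊔ q.maxParam) := by
  induction p using Pre.rec_on with
  | of f => exact (sup_of_le_right (unitInterval.nonneg' : (0 : I) ≤ s ⊔ q.maxParam)).symm
  | cons f t p ih => rw [Pre.cons_glue, Pre.maxParam_cons, ih, Pre.maxParam_cons, sup_assoc]

theorem Face.maxParam_eq {a b : V} {p q : Pre Γ a b} (h : Face Γ p q) :
    p.maxParam = q.maxParam := by
  induction h with
  | last f g => exact sup_idem _
  | head f g t p =>
    exact sup_of_le_right (unitInterval.nonneg' : (0 : I) ≤ t ⊔ p.maxParam)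
  | tail f t _ ih => rw [Pre.maxParam_cons, ih, Pre.maxParam_cons]

theorem Pre.continuous_maxParam {a b : V} : Continuous (Pre.maxParam : Pre Γ a b → I) := by
  refine continuous_sigma fun l => ?_
  induction l with
  | single f => exact continuous_const
  | cons f l ih =>
    have h0 : Continuous fun q : Fin (l.inner + 1) → I => q 0 := continuous_apply 0
    have h1 : Continuous fun q : Fin (l.inner + 1) → I => Fin.tail q :=
      continuous_pi fun i => continuous_apply i.succ
    exact h0.sup (ih.comp h1)

/-- The map of the interval that is `0` on `[0, 1/3]`, `1` on `[2/3, 1]` and affine between. -/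
noncomputable def stretch (t : I) : I := Set.projIcc 0 1 zero_le_one (3 * (t : ℝ) - 1)

theorem continuous_stretch : Continuous stretch :=
  continuous_projIcc.comp (by fun_prop)

theorem stretch_eq_zero {t : I} (h : (t : ℝ) ≤ 1 / 3) : stretch t = 0 :=
  Set.projIcc_of_le_left _ (by linarith)

theorem stretch_zero : stretch 0 = 0 := stretch_eq_zero (by norm_num)

theorem stretch_eq_one {t : I} (h : 2 / 3 ≤ (t : ℝ)) : stretch t = 1 :=
  Set.projIcc_of_right_le _ (by linarith)

/-- Stretching all the parameters of a point. -/
noncomputable def Pre.stretch {a b : V} (p : Pre Γ a b) : Pre Γ a b :=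
  ⟨p.1, fun i => HigherOps.stretch (p.2 i)⟩

theorem Pre.continuous_stretch {a b : V} : Continuous (Pre.stretch : Pre Γ a b → Pre Γ a b) :=
  continuous_sigma fun l => (Pre.continuous_mk l).comp
    (continuous_pi fun i => HigherOps.continuous_stretch.comp (continuous_apply i))

theorem Pre.stretch_of {a b : V} (f : Γ.Hom a b) : (Pre.of f).stretch = Pre.of f :=
  congrArg (Sigma.mk (Chain.single f)) (funext fun i => Fin.elim0 i)

theorem Pre.stretch_cons {a b c : V} (f : Γ.Hom b c) (t : I) (p : Pre Γ a b) :
    (Pre.cons f t p).stretch = Pre.cons f (HigherOps.stretch t) p.stretch :=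
  congrArg (Sigma.mk (Chain.cons f p.1)) (funext fun i => by
    change Fin (p.1.inner + 1) at i
    refine Fin.cases rfl (fun i => rfl) i)

theorem Pre.stretch_glue {a b c : V} (p : Pre Γ b c) (s : I) (q : Pre Γ a b) :
    (p.glue s q).stretch = p.stretch.glue (HigherOps.stretch s) q.stretch := by
  induction p using Pre.rec_on with
  | of f => rw [Pre.of_glue, Pre.stretch_cons, Pre.stretch_of, Pre.of_glue]
  | cons f t p ih => rw [Pre.cons_glue, Pre.stretch_cons, ih, Pre.stretch_cons, Pre.cons_glue]

theorem Face.stretch {a b : V} {p q : Pre Γ a b} (h : Face Γ p q) :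
    Face Γ p.stretch q.stretch := by
  induction h with
  | last f g =>
    rw [Pre.stretch_cons, Pre.stretch_of, Pre.stretch_of, stretch_zero]
    exact .last f g
  | head f g t p =>
    rw [Pre.stretch_cons, Pre.stretch_cons, Pre.stretch_cons, stretch_zero]
    exact .head f g _ _
  | tail f t _ ih =>
    rw [Pre.stretch_cons, Pre.stretch_cons]
    exact .tail f _ ih

theorem Face.glue_left {a b c : V} {p p' : Pre Γ b c} (h : Face Γ p p') (s : I) (q : Pre Γ a b) :
    Face Γ (p.glue s q) (p'.glue s q) := by
  induction h with
  | last f g => exact .head f g s q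
  | head f g t p => exact .head f g t (p.glue s q)
  | tail f t _ ih => exact .tail f t ih

theorem Face.glue_right {a b c : V} (p : Pre Γ b c) (s : I) {q q' : Pre Γ a b} (h : Face Γ q q') :
    Face Γ (p.glue s q) (p.glue s q') := by
  induction p using Pre.rec_on with
  | of f => exact .tail f s h
  | cons f t p ih => exact .tail f t (ih h)

theorem W.mk_eq {a b : V} {p q : Pre Γ a b} (h : Face Γ p q) : W.mk p = W.mk q := Quot.sound h

theorem W.mk_cons_congr {a b c : V} (f : Γ.Hom b c) (t : I) {p q : Pre Γ a b}
    (h : W.mk p = W.mk q) : W.mk (Pre.cons f t p) = W.mk (Pre.cons f t q) := by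
  have h' := Quot.eqvGen_exact h
  clear h
  induction h' with
  | rel _ _ h => exact W.mk_eq (.tail f t h)
  | refl => rfl
  | symm _ _ _ ih => exact ih.symm
  | trans _ _ _ _ _ ih₁ ih₂ => exact ih₁.trans ih₂

/-- Every parameter stretches to `0`, so all arrows get composed. This is what matches the two
recipes for a segment at defect `1/3`. -/
theorem W.mk_stretch_eq_ofArrow {a b : V} {p : Pre Γ a b} (h : (p.maxParam : ℝ) ≤ 1 / 3) :
    W.mk p.stretch = W.ofArrow p.1.total := by
  induction p using Pre.rec_on with
  | of f => rw [Pre.stretch_of]; rfl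
  | cons f t p ih =>
    rw [Pre.maxParam_cons] at h
    have ht : (t : ℝ) ≤ 1 / 3 := le_trans (Subtype.coe_le_coe.2 le_sup_left) h
    have hp : (p.maxParam : ℝ) ≤ 1 / 3 := le_trans (Subtype.coe_le_coe.2 le_sup_right) h
    rw [Pre.stretch_cons, stretch_eq_zero ht, W.mk_cons_congr f 0 (ih hp)]
    exact W.mk_eq (.last f p.1.total)

/-! ### The quotient map onto `WΓ(a, b)` is proper -/

/-- Directedness and finiteness of the nodes make the existence of an arrow a well-founded relation,
which permits induction on the target. Hence `Pre Γ a b` is a finite union of cubes, so compact. -/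
instance Chain.finite (a b : V) : Finite (Chain Γ a b) := by
  have := Γ.finite_nodes
  let r : V → V → Prop := fun x y => Nonempty (Γ.Hom x y)
  have : IsTrans V r := ⟨fun _ _ _ ⟨f⟩ ⟨g⟩ => ⟨Γ.comp g f⟩⟩
  have : Std.Irrefl r := ⟨fun x ⟨f⟩ => (Γ.directed x).false f⟩
  induction b using (Finite.wellFounded_of_trans_of_irrefl r).induction with
  | _ b ih =>
    have := Γ.finite_hom
    have : ∀ c, Finite (Γ.Hom c b × Chain Γ a c) := fun c => by
      rcases isEmpty_or_nonempty (Γ.Hom c b) with h | h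
      · infer_instance
      · have := ih c h
        infer_instance
    let φ : Γ.Hom a b ⊕ (Σ c, Γ.Hom c b × Chain Γ a c) → Chain Γ a b :=
      Sum.elim .single fun q => .cons q.2.1 q.2.2
    refine Finite.of_surjective φ fun l => ?_
    cases l with
    | single f => exact ⟨.inl f, rfl⟩
    | cons f l => exact ⟨.inr ⟨_, f, l⟩, rfl⟩

/-- The point `f ∘_0 p`, with the first two arrows composed. -/
def Pre.merge {a b c : V} (f : Γ.Hom b c) : Pre Γ a b → Pre Γ a c
  | ⟨.single g, _⟩ => Pre.of (Γ.comp f g)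
  | ⟨.cons g l, t⟩ => ⟨.cons (Γ.comp f g) l, t⟩

theorem Pre.continuous_merge {a b c : V} (f : Γ.Hom b c) :
    Continuous (Pre.merge f : Pre Γ a b → Pre Γ a c) := by
  refine continuous_sigma fun l => ?_
  cases l with
  | single g => exact continuous_const
  | cons g l =>
    exact Pre.continuous_mk (.cons (Γ.comp f g) l)

theorem Pre.face_merge {a b c : V} (f : Γ.Hom b c) (p : Pre Γ a b) :
    Face Γ (Pre.cons f 0 p) (Pre.merge f p) := by
  induction p using Pre.rec_on with
  | of g => exact .last f g
  | cons g t p => exact .head f g t p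

theorem Pre.merge_merge {a b c d : V} (f : Γ.Hom c d) (g : Γ.Hom b c) (p : Pre Γ a b) :
    Pre.merge f (Pre.merge g p) = Pre.merge (Γ.comp f g) p := by
  rcases p with ⟨_ | ⟨h, l⟩, t⟩
  · exact congrArg Pre.of (Γ.assoc f g _).symm
  · exact congrArg (fun k => (⟨.cons k l, t⟩ : Pre Γ a d)) (Γ.assoc f g h).symm

open Classical in
/-- Auxiliary recursion for `Pre.nf`. -/
noncomputable def Chain.nf {a b : V} : (l : Chain Γ a b) → (Fin l.inner → I) → Pre Γ a b
  | .single f, _ => Pre.of f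
  | .cons f l, t =>
    if t (0 : Fin (l.inner + 1)) = 0 then Pre.merge f (l.nf (Fin.tail (n := l.inner) t))
    else Pre.cons f (t (0 : Fin (l.inner + 1))) (l.nf (Fin.tail (n := l.inner) t))

/-- The normal form of a point: all the arrows joined by a parameter `0` are composed. -/
noncomputable def Pre.nf {a b : V} (p : Pre Γ a b) : Pre Γ a b := p.1.nf p.2

open Classical in
theorem Pre.nf_cons {a b c : V} (f : Γ.Hom b c) (t : I) (p : Pre Γ a b) :
    (Pre.cons f t p).nf = if t = 0 then Pre.merge f p.nf else Pre.cons f t p.nf := rfl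

theorem Face.nf_eq {a b : V} {p q : Pre Γ a b} (h : Face Γ p q) : p.nf = q.nf := by
  induction h with
  | last f g => rw [Pre.nf_cons, if_pos rfl]; rfl
  | head f g t p =>
    rw [Pre.nf_cons, if_pos rfl, Pre.nf_cons, Pre.nf_cons]
    split_ifs
    · exact Pre.merge_merge f g _
    · rfl
  | tail f t _ ih => rw [Pre.nf_cons, Pre.nf_cons, ih]

theorem W.nf_eq {a b : V} {p q : Pre Γ a b} (h : W.mk p = W.mk q) : p.nf = q.nf :=
  congrArg (Quot.lift Pre.nf fun _ _ h => Face.nf_eq h) h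

/-- Auxiliary recursion for `Pre.Red`. -/
def Chain.Red {a b : V} : (l : Chain Γ a b) → (Fin l.inner → I) → Pre Γ a b → Prop
  | .single f, _, r => r = Pre.of f
  | .cons f l, t, r => ∃ s, l.Red (Fin.tail (n := l.inner) t) s ∧
      (r = Pre.cons f (t (0 : Fin (l.inner + 1))) s ∨
        (t (0 : Fin (l.inner + 1)) = 0 ∧ r = Pre.merge f s))

/-- `p.Red r`: some of the pairs of arrows of `p` joined by a parameter `0` are composed in `r`. -/
def Pre.Red {a b : V} (p r : Pre Γ a b) : Prop := p.1.Red p.2 r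

theorem Pre.red_nf {a b : V} (p : Pre Γ a b) : p.Red p.nf := by
  induction p using Pre.rec_on with
  | of f => rfl
  | cons f t p ih =>
    refine ⟨p.nf, ih, ?_⟩
    rw [Pre.nf_cons]
    split_ifs with h
    · exact .inr ⟨h, rfl⟩
    · exact .inl rfl

theorem Pre.Red.mk_eq {a b : V} {p r : Pre Γ a b} (h : p.Red r) : W.mk p = W.mk r := by
  induction p using Pre.rec_on with
  | of f => exact congrArg W.mk (Eq.symm h)
  | cons f t p ih =>
    obtain ⟨s, hs, h | ⟨h0, h⟩⟩ := h
    · rw [h]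
      exact W.mk_cons_congr f t (ih hs)
    · change t = 0 at h0
      rw [h, h0, W.mk_cons_congr f 0 (ih hs)]
      exact W.mk_eq (Pre.face_merge f s)

/-- The normal form jumps when a parameter tends to `0`; `Red` is a closed relation containing its
graph. For `cons`, the relation is the projection of a closed set along the compact space of reducts
`s` of the tail. -/
theorem Pre.isClosed_red {a b : V} : IsClosed {q : Pre Γ a b × Pre Γ a b | q.1.Red q.2} := by
  have key : ∀ l : Chain Γ a b,
      IsClosed {q : (Fin l.inner → I) × Pre Γ a b | l.Red q.1 q.2} := by
    intro l
    induction l with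
    | single f => exact isClosed_singleton.preimage continuous_snd
    | @cons b c f l ih =>
      let Z := Pre Γ a b × ((Fin (l.inner + 1) → I) × Pre Γ a c)
      have h0 : Continuous fun z : Z => z.2.1 0 := by fun_prop
      have h1 : Continuous fun z : Z => Fin.tail z.2.1 :=
        continuous_pi fun i => (continuous_apply i.succ).comp (by fun_prop)
      have c1 : IsClosed {z : Z | l.Red (Fin.tail z.2.1) z.1} :=
        ih.preimage (h1.prodMk continuous_fst)
      have c2 : IsClosed {z : Z | z.2.2 = Pre.cons f (z.2.1 0) z.1} :=
        isClosed_eq (by fun_prop) ((Pre.continuous_cons f).comp (h0.prodMk continuous_fst))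
      have c3 : IsClosed {z : Z | z.2.1 0 = 0 ∧ z.2.2 = Pre.merge f z.1} :=
        (isClosed_eq h0 continuous_const).inter
          (isClosed_eq (by fun_prop) ((Pre.continuous_merge f).comp continuous_fst))
      change IsClosed {q : (Fin (l.inner + 1) → I) × Pre Γ a c | (Chain.cons f l).Red q.1 q.2}
      convert isClosedMap_snd_of_compactSpace _ (c1.inter (c2.union c3)) using 1
      ext ⟨t, r⟩
      constructor
      · rintro ⟨s, h⟩
        exact ⟨(s, t, r), h, rfl⟩
      · rintro ⟨⟨s, t', r'⟩, h, e⟩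
        cases e
        exact ⟨s, h⟩
  -- A set is open exactly when its predicate is continuous into the Sierpiński space `Prop`, so
  -- openness of the complement can be tested cube by cube.
  have h : Continuous fun q : Pre Γ a b × Pre Γ a b => ¬q.1.Red q.2 :=
    continuous_sigma_prod fun l => continuous_Prop.2 (key l).isOpen_compl
  exact ⟨continuous_Prop.1 h⟩

/-- Two points are equivalent iff they have a common reduct: equivalent points share their normal
form, and reduction preserves the class. Projecting away the reduct keeps the set closed, by
compactness. -/
theorem W.isClosed_mk_eq {a b : V} :
    IsClosed {q : Pre Γ a b × Pre Γ a b | W.mk q.1 = W.mk q.2} := by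
  have c1 : IsClosed {z : Pre Γ a b × (Pre Γ a b × Pre Γ a b) | z.2.1.Red z.1} :=
    Pre.isClosed_red.preimage ((continuous_fst.comp continuous_snd).prodMk continuous_fst)
  have c2 : IsClosed {z : Pre Γ a b × (Pre Γ a b × Pre Γ a b) | z.2.2.Red z.1} :=
    Pre.isClosed_red.preimage ((continuous_snd.comp continuous_snd).prodMk continuous_fst)
  convert isClosedMap_snd_of_compactSpace _ (c1.inter c2) using 1
  ext ⟨p, q⟩
  constructor
  · intro h
    exact ⟨(p.nf, p, q), ⟨p.red_nf, by rw [W.nf_eq h]; exact q.red_nf⟩, rfl⟩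
  · rintro ⟨⟨r, p', q'⟩, ⟨h1, h2⟩, e⟩
    cases e
    exact h1.mk_eq.trans h2.mk_eq.symm

theorem W.isQuotientMap_mk {a b : V} : Topology.IsQuotientMap (W.mk : Pre Γ a b → W Γ a b) :=
  isQuotientMap_quot_mk

theorem W.isProperMap_mk {a b : V} : IsProperMap (W.mk : Pre Γ a b → W Γ a b) := by
  have hc : IsClosedMap (W.mk : Pre Γ a b → W Γ a b) := by
    intro C hC
    rw [← W.isQuotientMap_mk.isClosed_preimage]
    convert isClosedMap_snd_of_compactSpace _
      (W.isClosed_mk_eq.inter (hC.preimage (continuous_fst (Y := Pre Γ a b)))) using 1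
    ext q
    constructor
    · rintro ⟨p, hp, e⟩
      exact ⟨(p, q), ⟨e, hp⟩, rfl⟩
    · rintro ⟨⟨p, q'⟩, ⟨e, hp⟩, rfl⟩
      exact ⟨p, hp, e⟩
  refine isProperMap_iff_isClosedMap_and_compact_fibers.2
    ⟨W.isQuotientMap_mk.continuous, hc, fun y => ?_⟩
  obtain ⟨p, rfl⟩ := W.isQuotientMap_mk.surjective y
  have : IsClosed {q : Pre Γ a b | W.mk q = W.mk p} :=
    W.isClosed_mk_eq.preimage (continuous_id.prodMk continuous_const)
  exact this.isCompact

/-- A product of a quotient map with an identity need not be a quotient map for general `Y`;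
properness survives the product and makes the map closed. -/
theorem W.isQuotientMap_mk_prod {a b : V} (Y : Type*) [TopologicalSpace Y] :
    Topology.IsQuotientMap (Prod.map W.mk id : Pre Γ a b × Y → W Γ a b × Y) :=
  (W.isProperMap_mk.prodMap isProperMap_id).isClosedMap.isQuotientMap
    (W.isQuotientMap_mk.continuous.prodMap continuous_id)
    (W.isQuotientMap_mk.surjective.prodMap Function.surjective_id)

/-! ### Deforming a functor along homotopies of the arrows -/

variable {X : V → PtSpace.{w}}

/-- Pointed homotopies that start at the values of the functor `B` on the arrows of `Γ`. -/
structure ArrowHomotopy (B : SpaceFunctor (Subcat.whole Γ) X) where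
  toMap : ∀ {a b : V}, Γ.Hom a b → C(I × X a, X b)
  apply_zero : ∀ {a b : V} (f : Γ.Hom a b) (x : X a),
    toMap f (0, x) = (B.map ⟨W.ofArrow f, trivial⟩).toMap x
  apply_base : ∀ {a b : V} (f : Γ.Hom a b) (s : I), toMap f (s, (X a).base) = (X b).base

/-- The value of `B` at the class of a point. -/
def SpaceFunctor.app (B : SpaceFunctor (Subcat.whole Γ) X) {a b : V} (p : Pre Γ a b) :
    X a → X b :=
  (B.map ⟨W.mk p, trivial⟩).toMap

theorem SpaceFunctor.app_base (B : SpaceFunctor (Subcat.whole Γ) X) {a b : V} (p : Pre Γ a b) :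
    B.app p (X a).base = (X b).base :=
  (B.map ⟨W.mk p, trivial⟩).map_base

theorem SpaceFunctor.app_congr (B : SpaceFunctor (Subcat.whole Γ) X) {a b : V} {p q : Pre Γ a b}
    (h : W.mk p = W.mk q) : B.app p = B.app q := by
  simp only [SpaceFunctor.app, h]

theorem SpaceFunctor.app_append (B : SpaceFunctor (Subcat.whole Γ) X) {a b c : V}
    (p : Pre Γ b c) (q : Pre Γ a b) (x : X a) : B.app (p.append q) x = B.app p (B.app q x) :=
  congrArg (fun m : PtMap (X a) (X c) => m.toMap x)
    (B.map_comp ⟨W.mk p, trivial⟩ ⟨W.mk q, trivial⟩)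

theorem SpaceFunctor.continuous_app (B : SpaceFunctor (Subcat.whole Γ) X) {a b : V} :
    Continuous fun q : Pre Γ a b × X a => B.app q.1 q.2 := by
  have h : Continuous fun q : Pre Γ a b × X a =>
      ((⟨W.mk q.1, trivial⟩ : (Subcat.whole Γ).mor a b), q.2) :=
    ((W.isQuotientMap_mk.continuous.comp continuous_fst).subtype_mk _).prodMk continuous_snd
  exact (B.continuous_map a b).comp h

namespace ArrowHomotopy

variable {B : SpaceFunctor (Subcat.whole Γ) X} (H : ArrowHomotopy B)

/-- The defect of a segment `p`, given the defects `l` and `r` at its ends. -/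
noncomputable def defect {a b : V} (p : Pre Γ a b) (l r : I) : ℝ := (p.maxParam ⊔ (l ⊔ r) : I)

/-- The value of the deformed functor on a segment `p` that is not broken, given the defects
`l` and `r` at its ends: if the total defect `μ` is at least `1/3`, this is the value of `B` at
the stretched point, otherwise it is the homotopy of the total composite at the time `1 - 3μ`. -/
noncomputable def segment {a b : V} (p : Pre Γ a b) (l r : I) (x : X a) : X b :=
  if 1 / 3 ≤ defect p l r then B.app p.stretch x
  else H.toMap p.1.total (Set.projIcc 0 1 zero_le_one (1 - 3 * defect p l r), x)

variable {H} in
theorem segment_of_le {a b : V} {p : Pre Γ a b} {l r : I} (h : 1 / 3 ≤ defect p l r) (x : X a) :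
    H.segment p l r x = B.app p.stretch x := if_pos h

theorem segment_congr {a b : V} {p q : Pre Γ a b} (h : Face Γ p q) (l r : I) :
    H.segment p l r = H.segment q l r := by
  funext x
  unfold segment defect
  rw [h.maxParam_eq, h.total_eq, B.app_congr (W.mk_eq h.stretch)]

theorem segment_base {a b : V} (p : Pre Γ a b) (l r : I) :
    H.segment p l r (X a).base = (X b).base := by
  unfold segment
  split_ifs
  · exact B.app_base _
  · exact H.apply_base _ _

theorem segment_of_zero {a b : V} (f : Γ.Hom a b) (x : X a) :
    H.segment (Pre.of f) 0 0 x = H.toMap f (1, x) := by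
  have h : defect (Pre.of f) 0 0 = 0 := by simp [defect, Pre.maxParam_of]
  unfold segment
  rw [h, if_neg (by norm_num), mul_zero, sub_zero, Set.projIcc_right]
  rfl

/-- At defect `1/3` the homotopy is at time `0`, hence equals `B` of the total composite, and the
stretched point represents that same composite. -/
theorem continuous_segment {Z : Type*} [TopologicalSpace Z] {a b : V} {p : Z → Pre Γ a b}
    {l r : Z → I} {x : Z → X a} (hp : Continuous p) (hl : Continuous l) (hr : Continuous r)
    (hx : Continuous x) : Continuous fun z => H.segment (p z) (l z) (r z) (x z) := by
  have hd : Continuous fun z => defect (p z) (l z) (r z) :=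
    continuous_subtype_val.comp ((Pre.continuous_maxParam.comp hp).sup (hl.sup hr))
  have hH : Continuous fun q : Pre Γ a b × (I × X a) => H.toMap q.1.1.total q.2 :=
    continuous_sigma_prod fun c => (H.toMap c.total).continuous.comp continuous_snd
  refine Continuous.if_le (B.continuous_app.comp ((Pre.continuous_stretch.comp hp).prodMk hx))
    (hH.comp (hp.prodMk ((continuous_projIcc.comp
      (continuous_const.sub (continuous_const.mul hd))).prodMk hx))) continuous_const hd ?_
  intro z hz
  have hm : ((p z).maxParam : ℝ) ≤ 1 / 3 := by
    rw [hz]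
    exact Subtype.coe_le_coe.2 le_sup_left
  rw [← hz, mul_one_div_cancel (by norm_num), sub_self, Set.projIcc_left, B.app_congr
    (W.mk_stretch_eq_ofArrow hm)]
  exact (H.apply_zero _ _).symm

/-- The value of the deformed functor on `q ∘_s p`, where `p` is given by a chain with parameters
and `q` is a segment with left defect `l` that is not broken. The chain is broken at the parameters
that are at least `2/3`. -/
noncomputable def glued {a b : V} : (c : Chain Γ a b) → (Fin c.inner → I) →
    ∀ {d : V}, Pre Γ b d → I → I → X a → X d
  | .single f, _, _, q, s, l, x =>
    if 2 / 3 ≤ (s : ℝ) then H.segment q l (σ s) (H.segment (Pre.of f) (σ s) 0 x)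
    else H.segment (q.glue s (Pre.of f)) l 0 x
  | .cons f c, t, _, q, s, l, x =>
    if 2 / 3 ≤ (s : ℝ) then
      H.segment q l (σ s) (glued c (Fin.tail (n := c.inner) t) (Pre.of f)
        (t (0 : Fin (c.inner + 1))) (σ s) x)
    else glued c (Fin.tail (n := c.inner) t) (q.glue s (Pre.of f)) (t (0 : Fin (c.inner + 1))) l x

/-- The value of the deformed functor on a point, given the defect at its left end. -/
noncomputable def value {a b : V} : Pre Γ a b → I → X a → X b
  | ⟨.single f, _⟩, l => H.segment (Pre.of f) l 0
  | ⟨.cons f c, t⟩, l => H.glued c (Fin.tail (n := c.inner) t) (Pre.of f)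
      (t (0 : Fin (c.inner + 1))) l

theorem value_of {a b : V} (f : Γ.Hom a b) (l : I) :
    H.value (Pre.of f) l = H.segment (Pre.of f) l 0 := rfl

theorem value_cons {a b c : V} (f : Γ.Hom b c) (t : I) (p : Pre Γ a b) (l : I) :
    H.value (Pre.cons f t p) l = H.glued p.1 p.2 (Pre.of f) t l := rfl

theorem glued_of_le {a b d : V} (p : Pre Γ a b) (q : Pre Γ b d) {s : I} (h : 2 / 3 ≤ (s : ℝ))
    (l : I) (x : X a) :
    H.glued p.1 p.2 q s l x = H.segment q l (σ s) (H.value p (σ s) x) := by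
  induction p using Pre.rec_on with
  | of f => exact if_pos h
  | cons f t p => exact if_pos h

theorem glued_of_of_not_le {a b d : V} (f : Γ.Hom a b) (q : Pre Γ b d) {s : I}
    (h : ¬2 / 3 ≤ (s : ℝ)) (l : I) (x : X a) :
    H.glued (Pre.of f).1 (Pre.of f).2 q s l x = H.segment (q.glue s (Pre.of f)) l 0 x :=
  if_neg h

theorem glued_cons_of_not_le {a b c d : V} (f : Γ.Hom b c) (t : I) (p : Pre Γ a b)
    (q : Pre Γ c d) {s : I} (h : ¬2 / 3 ≤ (s : ℝ)) (l : I) (x : X a) :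
    H.glued (Pre.cons f t p).1 (Pre.cons f t p).2 q s l x =
      H.glued p.1 p.2 (q.glue s (Pre.of f)) t l x :=
  if_neg h

/-! ### Compatibility with the face identifications -/

theorem glued_congr_left {a b d : V} (p : Pre Γ a b) {q q' : Pre Γ b d} (h : Face Γ q q')
    (s l : I) (x : X a) : H.glued p.1 p.2 q s l x = H.glued p.1 p.2 q' s l x := by
  induction p using Pre.rec_on generalizing d s l with
  | of f =>
    by_cases hs : 2 / 3 ≤ (s : ℝ)
    · rw [H.glued_of_le _ _ hs, H.glued_of_le _ _ hs, H.segment_congr h]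
    · rw [H.glued_of_of_not_le _ _ hs, H.glued_of_of_not_le _ _ hs,
        H.segment_congr (h.glue_left s _)]
  | cons f t p ih =>
    by_cases hs : 2 / 3 ≤ (s : ℝ)
    · rw [H.glued_of_le _ _ hs, H.glued_of_le _ _ hs, H.segment_congr h]
    · rw [H.glued_cons_of_not_le _ _ _ _ hs, H.glued_cons_of_not_le _ _ _ _ hs]
      exact ih (h.glue_left s _) t l x

theorem not_two_thirds_le_zero : ¬2 / 3 ≤ ((0 : I) : ℝ) := by norm_num

/-- A parameter `0` is never a cut, so the two arrows it joins lie in one segment. `value` and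
`glued` are treated together because each calls the other: a cut restarts with `value`, and `value`
of a `cons` is a `glued`. -/
theorem value_and_glued_congr {a b : V} {p p' : Pre Γ a b} (h : Face Γ p p') :
    (∀ (l : I) (x : X a), H.value p l x = H.value p' l x) ∧
    ∀ {d : V} (q : Pre Γ b d) (s l : I) (x : X a),
      H.glued p.1 p.2 q s l x = H.glued p'.1 p'.2 q s l x := by
  induction h with
  | @last b c f g =>
    have hv : ∀ (l : I) (x : X a), H.value (Pre.cons f 0 (Pre.of g)) l x =
        H.value (Pre.of (Γ.comp f g)) l x := fun l x => by
      rw [H.value_cons, H.glued_of_of_not_le _ _ not_two_thirds_le_zero, H.value_of]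
      exact congrFun (H.segment_congr (.last f g) l 0) x
    refine ⟨hv, fun q s l x => ?_⟩
    by_cases hs : 2 / 3 ≤ (s : ℝ)
    · rw [H.glued_of_le _ _ hs, H.glued_of_le _ _ hs, hv]
    · rw [H.glued_cons_of_not_le _ _ _ _ hs, H.glued_of_of_not_le _ _ not_two_thirds_le_zero,
        H.glued_of_of_not_le _ _ hs, Pre.glue_assoc]
      exact congrFun (H.segment_congr (Face.glue_right q s (.last f g)) l 0) x
  | @head b c d f g t p =>
    have hv : ∀ (l : I) (x : X a), H.value (Pre.cons f 0 (Pre.cons g t p)) l x =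
        H.value (Pre.cons (Γ.comp f g) t p) l x := fun l x => by
      rw [H.value_cons, H.glued_cons_of_not_le _ _ _ _ not_two_thirds_le_zero, H.value_cons]
      exact H.glued_congr_left p (.last f g) t l x
    refine ⟨hv, fun q s l x => ?_⟩
    by_cases hs : 2 / 3 ≤ (s : ℝ)
    · rw [H.glued_of_le _ _ hs, H.glued_of_le _ _ hs, hv]
    · rw [H.glued_cons_of_not_le _ _ _ _ hs, H.glued_cons_of_not_le _ _ _ _ not_two_thirds_le_zero,
        H.glued_cons_of_not_le _ _ _ _ hs, Pre.glue_assoc]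
      exact H.glued_congr_left p (Face.glue_right q s (.last f g)) t l x
  | @tail b c f t p p' _ ih =>
    have hv : ∀ (l : I) (x : X a), H.value (Pre.cons f t p) l x =
        H.value (Pre.cons f t p') l x := fun l x => ih.2 (Pre.of f) t l x
    refine ⟨hv, fun q s l x => ?_⟩
    by_cases hs : 2 / 3 ≤ (s : ℝ)
    · rw [H.glued_of_le _ _ hs, H.glued_of_le _ _ hs, hv]
    · rw [H.glued_cons_of_not_le _ _ _ _ hs, H.glued_cons_of_not_le _ _ _ _ hs]
      exact ih.2 _ t l x

theorem value_congr {a b : V} {p p' : Pre Γ a b} (h : Face Γ p p') (l : I) :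
    H.value p l = H.value p' l :=
  funext fun x => (H.value_and_glued_congr h).1 l x

/-! ### Compatibility with composition and base points -/

theorem glued_one {a b d : V} (p : Pre Γ a b) (q : Pre Γ b d) (l : I) (x : X a) :
    H.glued p.1 p.2 q 1 l x = H.segment q l 0 (H.value p 0 x) := by
  rw [H.glued_of_le p q (by norm_num), unitInterval.symm_one]

/-- The junction parameter `1` is a cut of defect `σ 1 = 0`, so both sides see the same defect as at
an outer end. -/
theorem value_and_glued_append {a b c : V} (p : Pre Γ b c) (r : Pre Γ a b) :
    (∀ (l : I) (x : X a), H.value (p.append r) l x = H.value p l (H.value r 0 x)) ∧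
    ∀ {d : V} (q : Pre Γ c d) (s l : I) (x : X a),
      H.glued (p.append r).1 (p.append r).2 q s l x =
        H.glued p.1 p.2 q s l (H.value r 0 x) := by
  induction p using Pre.rec_on with
  | of f =>
    have hv : ∀ (l : I) (x : X a), H.value ((Pre.of f).append r) l x =
        H.value (Pre.of f) l (H.value r 0 x) := fun l x => H.glued_one r (Pre.of f) l x
    refine ⟨hv, fun q s l x => ?_⟩
    by_cases hs : 2 / 3 ≤ (s : ℝ)
    · rw [H.glued_of_le _ _ hs, H.glued_of_le _ _ hs, hv]
    · rw [Pre.of_append, H.glued_cons_of_not_le _ _ _ _ hs, H.glued_of_of_not_le _ _ hs,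
        H.glued_one]
  | cons f t p ih =>
    have hv : ∀ (l : I) (x : X a), H.value ((Pre.cons f t p).append r) l x =
        H.value (Pre.cons f t p) l (H.value r 0 x) := fun l x => (ih r).2 (Pre.of f) t l x
    refine ⟨hv, fun q s l x => ?_⟩
    by_cases hs : 2 / 3 ≤ (s : ℝ)
    · rw [H.glued_of_le _ _ hs, H.glued_of_le _ _ hs, hv]
    · rw [Pre.cons_append, H.glued_cons_of_not_le _ _ _ _ hs, H.glued_cons_of_not_le _ _ _ _ hs]
      exact (ih r).2 _ t l x

theorem value_append {a b c : V} (p : Pre Γ b c) (r : Pre Γ a b) (l : I) (x : X a) :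
    H.value (p.append r) l x = H.value p l (H.value r 0 x) :=
  (H.value_and_glued_append p r).1 l x

theorem value_and_glued_base {a b : V} (p : Pre Γ a b) :
    (∀ l : I, H.value p l (X a).base = (X b).base) ∧
    ∀ {d : V} (q : Pre Γ b d) (s l : I), H.glued p.1 p.2 q s l (X a).base = (X d).base := by
  induction p using Pre.rec_on with
  | of f =>
    have hv := fun l => H.segment_base (Pre.of f) l 0
    refine ⟨hv, fun q s l => ?_⟩
    by_cases hs : 2 / 3 ≤ (s : ℝ)
    · rw [H.glued_of_le _ _ hs, H.value_of, hv, H.segment_base]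
    · rw [H.glued_of_of_not_le _ _ hs, H.segment_base]
  | cons f t p ih =>
    have hv := fun l => ih.2 (Pre.of f) t l
    refine ⟨hv, fun q s l => ?_⟩
    by_cases hs : 2 / 3 ≤ (s : ℝ)
    · rw [H.glued_of_le _ _ hs, H.value_cons, hv, H.segment_base]
    · rw [H.glued_cons_of_not_le _ _ _ _ hs]
      exact ih.2 _ t l

theorem value_base {a b : V} (p : Pre Γ a b) (l : I) : H.value p l (X a).base = (X b).base :=
  (H.value_and_glued_base p).1 l

/-! #### Continuity -/

theorem le_defect_of_left {a b : V} (p : Pre Γ a b) {l : I} (h : 1 / 3 ≤ (l : ℝ)) (r : I) :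
    1 / 3 ≤ defect p l r :=
  h.trans (Subtype.coe_le_coe.2 (le_sup_left.trans le_sup_right))

theorem le_defect_of_right {a b : V} (p : Pre Γ a b) (l : I) {r : I} (h : 1 / 3 ≤ (r : ℝ)) :
    1 / 3 ≤ defect p l r :=
  h.trans (Subtype.coe_le_coe.2 (le_sup_right.trans le_sup_right))

theorem le_defect_glue {a b c : V} (p : Pre Γ b c) {s : I} (h : 1 / 3 ≤ (s : ℝ)) (q : Pre Γ a b)
    (l r : I) : 1 / 3 ≤ defect (p.glue s q) l r := by
  unfold defect
  rw [Pre.maxParam_glue]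
  exact h.trans (Subtype.coe_le_coe.2 ((le_sup_left.trans le_sup_right).trans le_sup_left))

theorem app_stretch_glue {a b c : V} (p : Pre Γ b c) {s : I} (h : 2 / 3 ≤ (s : ℝ)) (q : Pre Γ a b)
    (x : X a) : B.app (p.glue s q).stretch x = B.app p.stretch (B.app q.stretch x) := by
  rw [Pre.stretch_glue, stretch_eq_one h, Pre.glue_one, B.app_append]

/-- At the parameter where a break appears, the segment to its left is given by `B`. -/
theorem glued_glue {a b c d : V} (p : Pre Γ a b) (q : Pre Γ c d) (y : Pre Γ b c) {s' : I}
    (h : (s' : ℝ) = 2 / 3) (s l : I) (x : X a) :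
    H.glued p.1 p.2 (q.glue s' y) s l x =
      B.app q.stretch (H.glued p.1 p.2 y s (σ s') x) := by
  have h₂ : 2 / 3 ≤ (s' : ℝ) := h.ge
  have h₁ : 1 / 3 ≤ (s' : ℝ) := by rw [h]; norm_num
  -- The defect `1 - 2/3` of a fresh cut is exactly the threshold `1/3`, so the segments touching it
  -- are evaluated by `B`.
  have h₁' : 1 / 3 ≤ ((σ s' : I) : ℝ) := by rw [unitInterval.coe_symm_eq, h]; norm_num
  have hbreak : ∀ {a b : V} (p : Pre Γ a b) (y : Pre Γ b c) (s : I) (x : X a), 2 / 3 ≤ (s : ℝ) →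
      H.glued p.1 p.2 (q.glue s' y) s l x =
        B.app q.stretch (H.glued p.1 p.2 y s (σ s') x) := by
    intro a b p y s x hs
    rw [H.glued_of_le _ _ hs, H.glued_of_le _ _ hs, segment_of_le (le_defect_glue q h₁ y l _),
      segment_of_le (le_defect_of_left y h₁' _), app_stretch_glue q h₂]
  induction p using Pre.rec_on generalizing s with
  | of f =>
    by_cases hs : 2 / 3 ≤ (s : ℝ)
    · exact hbreak _ y s x hs
    · rw [H.glued_of_of_not_le _ _ hs, H.glued_of_of_not_le _ _ hs, Pre.glue_assoc,
        segment_of_le (le_defect_glue q h₁ _ l _), segment_of_le (le_defect_of_left _ h₁' _),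
        app_stretch_glue q h₂]
  | cons f t p ih =>
    by_cases hs : 2 / 3 ≤ (s : ℝ)
    · exact hbreak _ y s x hs
    · rw [H.glued_cons_of_not_le _ _ _ _ hs, H.glued_cons_of_not_le _ _ _ _ hs, Pre.glue_assoc]
      exact ih _ t x

/-- Only the wall `s = 2/3` needs care. With a longer chain the segment to the right of the new cut
may continue past several more arrows, whence the appeal to `glued_glue`. -/
theorem continuous_glued {Z : Type*} [TopologicalSpace Z] {a b d : V} (c : Chain Γ a b)
    {t : Z → Fin c.inner → I} {q : Z → Pre Γ b d} {s l : Z → I} {x : Z → X a}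
    (ht : Continuous t) (hq : Continuous q) (hs : Continuous s) (hl : Continuous l)
    (hx : Continuous x) : Continuous fun z => H.glued c (t z) (q z) (s z) (l z) (x z) := by
  have hσ : ∀ {s : I}, 2 / 3 = (s : ℝ) → 1 / 3 ≤ ((σ s : I) : ℝ) := fun h => by
    rw [unitInterval.coe_symm_eq, ← h]; norm_num
  induction c generalizing d s l with
  | single f =>
    have hσs := unitInterval.continuous_symm.comp hs
    refine Continuous.if_le
      (H.continuous_segment hq hl hσs (H.continuous_segment continuous_const hσs
        continuous_const hx))
      (H.continuous_segment ((Pre.continuous_glue_of f).comp (hq.prodMk hs)) hl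
        continuous_const hx) continuous_const (continuous_subtype_val.comp hs) fun z hz => ?_
    change 2 / 3 = (s z : ℝ) at hz
    have h₁ : 1 / 3 ≤ (s z : ℝ) := by rw [← hz]; norm_num
    rw [segment_of_le (le_defect_of_right _ _ (hσ hz)),
      segment_of_le (le_defect_of_left _ (hσ hz) _), segment_of_le (le_defect_glue _ h₁ _ _ _),
      app_stretch_glue _ hz.le]
  | cons f c ih =>
    have hσs := unitInterval.continuous_symm.comp hs
    have h0 : Continuous fun z => t z (0 : Fin (c.inner + 1)) :=
      (continuous_apply (0 : Fin (c.inner + 1))).comp ht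
    have h1 : Continuous fun z => Fin.tail (n := c.inner) (t z) :=
      continuous_pi fun i => (continuous_apply i.succ).comp ht
    refine Continuous.if_le
      (H.continuous_segment hq hl hσs (ih h1 continuous_const h0 hσs))
      (ih h1 ((Pre.continuous_glue_of f).comp (hq.prodMk hs)) h0 hl)
      continuous_const (continuous_subtype_val.comp hs) fun z hz => ?_
    change 2 / 3 = (s z : ℝ) at hz
    rw [segment_of_le (le_defect_of_right _ _ (hσ hz))]
    exact (H.glued_glue ⟨c, Fin.tail (n := c.inner) (t z)⟩ (q z) (Pre.of f) hz.symm _ _ _).symm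

theorem continuous_value {a b : V} :
    Continuous fun q : Pre Γ a b × X a => H.value q.1 0 q.2 := by
  refine continuous_sigma_prod fun c => ?_
  cases c with
  | single f =>
    exact H.continuous_segment continuous_const continuous_const continuous_const continuous_snd
  | cons f c =>
    have h0 : Continuous fun z : (Fin (c.inner + 1) → I) × X a => z.1 0 := by fun_prop
    have h1 : Continuous fun z : (Fin (c.inner + 1) → I) × X a => Fin.tail z.1 :=
      continuous_pi fun i => (continuous_apply i.succ).comp continuous_fst
    exact H.continuous_glued c h1 continuous_const h0 continuous_const continuous_snd

/-- The value of the deformed functor on a morphism of `WΓ`. -/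
noncomputable def deformMap {a b : V} (y : W Γ a b) : X a → X b :=
  Quot.lift (fun p => H.value p 0) (fun _ _ h => H.value_congr h 0) y

theorem continuous_deformMap {a b : V} :
    Continuous fun q : W Γ a b × X a => H.deformMap q.1 q.2 :=
  (W.isQuotientMap_mk_prod (X a)).continuous_iff.2 H.continuous_value

/-- The functor obtained from `B` by deforming its values on arrows along the homotopies `H`. -/
noncomputable def deform : SpaceFunctor (Subcat.whole Γ) X where
  map {a b} y :=
    { toMap := ⟨H.deformMap y.1, H.continuous_deformMap.comp (Continuous.prodMk_right y.1)⟩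
      map_base := by
        obtain ⟨⟨p⟩, _⟩ := y
        exact H.value_base p 0 }
  map_comp y z := by
    obtain ⟨⟨p⟩, _⟩ := y
    obtain ⟨⟨q⟩, _⟩ := z
    ext x
    exact H.value_append p q 0 x
  continuous_map a b := H.continuous_deformMap.comp
    ((continuous_subtype_val.comp continuous_fst).prodMk continuous_snd)

theorem deform_ofArrow {a b : V} (f : Γ.Hom a b) (x : X a) :
    (H.deform.map ⟨W.ofArrow f, trivial⟩).toMap x = H.toMap f (1, x) :=
  H.segment_of_zero f x

end ArrowHomotopy

/-! ### The vertices of `bWΓ` -/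

theorem DiagramLattice.isEmpty_hom_init (Γ : DiagramLattice.{u, v} V) (a : V) :
    IsEmpty (Γ.Hom a Γ.init) := by
  refine ⟨fun f => ?_⟩
  by_cases h : a = Γ.init
  · subst h
    exact (Γ.directed _).false f
  · exact (Γ.directed _).false (Γ.comp f (Γ.weak_init a h).some)

theorem DiagramLattice.isEmpty_fin_hom (Γ : DiagramLattice.{u, v} V) (a : V) :
    IsEmpty (Γ.Hom Γ.fin a) := by
  refine ⟨fun f => ?_⟩
  by_cases h : a = Γ.fin
  · subst h
    exact (Γ.directed _).false f
  · exact (Γ.directed _).false (Γ.comp (Γ.weak_fin a h).some f)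

/-- The largest parameter of a morphism of `WΓ`. -/
def W.maxParam {a b : V} (x : W Γ a b) : I :=
  Quot.lift Pre.maxParam (fun _ _ h => h.maxParam_eq) x

theorem W.maxParam_comp {a b c : V} (x : W Γ b c) (y : W Γ a b) : (x.comp y).maxParam = 1 := by
  induction x using Quot.ind with | _ p
  induction y using Quot.ind with | _ q
  change (p.append q).maxParam = 1
  rw [← Pre.glue_one, Pre.maxParam_glue]
  exact le_antisymm unitInterval.le_one' (le_sup_left.trans le_sup_right)

/-- An arrow of `Γ` is indecomposable in `WΓ`. -/
theorem W.ofArrow_ne_comp {a b c : V} (f : Γ.Hom a c) (x : W Γ b c) (y : W Γ a b) :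
    W.ofArrow f ≠ x.comp y := by
  intro h
  have := congrArg W.maxParam h
  rw [W.maxParam_comp] at this
  exact zero_ne_one this

theorem W.ofArrow_mem_basis {a b : V} {f : Γ.Hom a b}
    (h : W.ofArrow f ∈ (Subcat.basis Γ).mor a b) : ¬(a = Γ.init ∧ b = Γ.fin) := by
  rintro ⟨ha, hb⟩
  obtain ⟨c, y, z, -, -, e⟩ := h ha hb
  exact W.ofArrow_ne_comp f y z e

/-- A point all of whose parameters are `0` or `1`. -/
def Pre.IsVertex {a b : V} (p : Pre Γ a b) : Prop := ∀ i, p.2 i = 0 ∨ p.2 i = 1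

theorem Pre.isVertex_cons {a b c : V} {f : Γ.Hom b c} {t : I} {p : Pre Γ a b} :
    (Pre.cons f t p).IsVertex ↔ (t = 0 ∨ t = 1) ∧ p.IsVertex :=
  Fin.forall_fin_succ (n := p.1.inner)
    (P := fun i => (Fin.cons t p.2 : Fin (p.1.inner + 1) → I) i = 0 ∨
      (Fin.cons t p.2 : Fin (p.1.inner + 1) → I) i = 1)

theorem Pre.IsVertex.mem_sk {a b : V} {p : Pre Γ a b} (hp : p.IsVertex) (k : ℕ)
    (h : ¬(a = Γ.init ∧ b = Γ.fin)) : W.mk p ∈ ((Subcat.basis Γ).sk k).mor a b :=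
  SkMem.face (U := Subcat.basis Γ) p.1 ∅ p.2 (fun i _ => hp i) (Nat.zero_le k)
    (fun _ _ ha hb => absurd ⟨ha, hb⟩ h) _ ⟨p.2, fun _ _ => rfl, rfl⟩

/-- A functor on `WΓ` extends a functor on the `0`-skeleton of `bWΓ` as soon as the two agree on
the arrows of `Γ` other than the maximal one. -/
theorem extends_of_ofArrow {X : V → PtSpace.{w}} {B : SpaceFunctor (Subcat.whole Γ) X}
    {F : SpaceFunctor ((Subcat.basis Γ).sk 0) X}
    (hBF : ∀ {a b : V} (f : Γ.Hom a b) (h : ¬(a = Γ.init ∧ b = Γ.fin)),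
      B.map ⟨W.ofArrow f, trivial⟩ = F.map ⟨W.ofArrow f, ofArrow_mem_sk_basis 0 f h⟩) :
    Extends B F := by
  let Good : ∀ {a b : V}, W Γ a b → Prop := fun {a b} y =>
    ∀ h : y ∈ ((Subcat.basis Γ).sk 0).mor a b, B.map ⟨y, trivial⟩ = F.map ⟨y, h⟩
  have good_comp : ∀ {a b c : V} {y : W Γ b c} {z : W Γ a b},
      y ∈ ((Subcat.basis Γ).sk 0).mor b c → z ∈ ((Subcat.basis Γ).sk 0).mor a b →
      Good y → Good z → Good (y.comp z) := by
    intro a b c y z hy hz gy gz h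
    exact (B.map_comp ⟨y, trivial⟩ ⟨z, trivial⟩).trans
      ((congrArg₂ PtMap.comp (gy hy) (gz hz)).trans (F.map_comp ⟨y, hy⟩ ⟨z, hz⟩).symm)
  have good_of : ∀ {a b : V} (f : Γ.Hom a b), W.ofArrow f ∈ (Subcat.basis Γ).mor a b →
      Good (W.ofArrow f) := fun f hf _ => hBF f (W.ofArrow_mem_basis hf)
  -- The middle node is neither `init` nor `fin`, so neither factor runs from `init` to `fin` and
  -- both lie in the `0`-skeleton, even when the composite itself does run from `init` to `fin`.
  have good_cons_one : ∀ {a b c : V} (f : Γ.Hom b c) (p : Pre Γ a b), p.IsVertex →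
      (W.mk p ∈ (Subcat.basis Γ).mor a b → Good (W.mk p)) → Good (W.mk (Pre.cons f 1 p)) := by
    intro a b c f p hp hg
    have hb : b ≠ Γ.init := by
      rintro rfl
      exact (Γ.isEmpty_hom_init a).false p.1.total
    have hb' : b ≠ Γ.fin := by
      rintro rfl
      exact (Γ.isEmpty_fin_hom c).false f
    have hf : ¬(b = Γ.init ∧ c = Γ.fin) := fun h => hb h.1
    have hpb : ¬(a = Γ.init ∧ b = Γ.fin) := fun h => hb' h.2
    exact good_comp (ofArrow_mem_sk_basis 0 f hf) (hp.mem_sk 0 hpb)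
      (good_of f fun h₁ h₂ => absurd ⟨h₁, h₂⟩ hf) (hg fun h₁ h₂ => absurd ⟨h₁, h₂⟩ hpb)
  -- The second clause strengthens the induction: when `t = 0`, the new arrow is absorbed into the
  -- first one and the claim is needed for the tail with another arrow in front. Membership in `bWΓ`
  -- stays a hypothesis to exclude the maximal arrow.
  have good_vertex : ∀ {a b : V} (p : Pre Γ a b), p.IsVertex →
      (W.mk p ∈ (Subcat.basis Γ).mor a b → Good (W.mk p)) ∧
      ∀ {c : V} (f : Γ.Hom b c) (t : I), t = 0 ∨ t = 1 →
        W.mk (Pre.cons f t p) ∈ (Subcat.basis Γ).mor a c → Good (W.mk (Pre.cons f t p)) := by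
    intro a b p hp
    induction p using Pre.rec_on with
    | of g =>
      refine ⟨good_of g, fun f t ht => ?_⟩
      rcases ht with rfl | rfl
      · rw [W.mk_eq (.last f g)]
        exact good_of _
      · exact fun _ => good_cons_one f _ hp (good_of g)
    | cons g s p ih =>
      obtain ⟨hs, hp'⟩ := Pre.isVertex_cons.1 hp
      have h1 := (ih hp').2 g s hs
      refine ⟨h1, fun f t ht => ?_⟩
      rcases ht with rfl | rfl
      · rw [W.mk_eq (.head f g s p)]
        exact (ih hp').2 _ s hs
      · exact fun _ => good_cons_one f _ hp h1
  have good : ∀ {a b : V} {y : W Γ a b}, SkMem 0 (Subcat.basis Γ) y → Good y := by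
    intro a b y hy
    induction hy with
    | face c S e he hS hU x hx =>
      have hS : S = ∅ := by simpa using hS
      subst hS
      obtain ⟨t, ht, rfl⟩ := id hx
      have hv : ∀ i, t i = 0 ∨ t i = 1 := fun i => by
        rw [ht i (Finset.notMem_empty i)]
        exact he i (Finset.notMem_empty i)
      exact (good_vertex ⟨c, t⟩ hv).1 (hU hx)
    | comp y z hy hz ihy ihz => exact good_comp hy hz ihy ihz
  exact fun a b y => good y.2 y.2

end HigherOps

/-! ### Proof of the proposition -/

theorem proposition3p16 {V : Type u} (Γ : HigherOps.DiagramLattice.{u, v} V)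
    (A : HigherOps.InitialData.{u, v, w} Γ)
    (h : ∃ F : HigherOps.SpaceFunctor ((HigherOps.Subcat.basis Γ).sk 0) A.obj,
      HigherOps.IsRealization 0 A F ∧
        ∃ B : HigherOps.SpaceFunctor (HigherOps.Subcat.whole Γ) A.obj, HigherOps.Extends B F)
    (F' : HigherOps.SpaceFunctor ((HigherOps.Subcat.basis Γ).sk 0) A.obj)
    (hF' : HigherOps.IsRealization 0 A F') :
    ∃ B' : HigherOps.SpaceFunctor (HigherOps.Subcat.whole Γ) A.obj, HigherOps.Extends B' F' := by
  obtain ⟨F, hF, B, hB⟩ := h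
  have key : ∀ (a b : V) (f : Γ.Hom a b), ∃ K : C(unitInterval × A.obj a, A.obj b),
      (∀ x, K (0, x) = (B.map ⟨HigherOps.W.ofArrow f, trivial⟩).toMap x) ∧
      (∀ s, K (s, (A.obj a).base) = (A.obj b).base) ∧
      ∀ hf : ¬(a = Γ.init ∧ b = Γ.fin), ∀ x, K (1, x) =
        (F'.map ⟨HigherOps.W.ofArrow f, HigherOps.ofArrow_mem_sk_basis 0 f hf⟩).toMap x := by
    intro a b f
    by_cases hf : a = Γ.init ∧ b = Γ.fin
    -- `F'` prescribes nothing on the maximal arrow, so the constant homotopy will do.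
    · exact ⟨(B.map ⟨HigherOps.W.ofArrow f, trivial⟩).toMap.comp ContinuousMap.snd,
        fun _ => rfl, fun _ => (B.map ⟨HigherOps.W.ofArrow f, trivial⟩).map_base,
        fun h => absurd hf h⟩
    · have e : (B.map ⟨HigherOps.W.ofArrow f, trivial⟩).cls = (F'.map
          ⟨HigherOps.W.ofArrow f, HigherOps.ofArrow_mem_sk_basis 0 f hf⟩).cls := by
        -- Both maps represent `A.map f`, the first because `B` extends the realization `F`.
        rw [hF' a b f hf, ← hF a b f hf,
          hB a b ⟨HigherOps.W.ofArrow f, HigherOps.ofArrow_mem_sk_basis 0 f hf⟩]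
      obtain ⟨K⟩ : ContinuousMap.HomotopicRel _ _ _ := Quotient.exact e
      exact ⟨K.toContinuousMap, K.apply_zero, fun s => (K.eq_fst s (Set.mem_singleton _)).trans
        (B.map ⟨HigherOps.W.ofArrow f, trivial⟩).map_base, fun _ => K.apply_one⟩
  choose K h0 hbase h1 using key
  let H : HigherOps.ArrowHomotopy B := ⟨fun {a b} f => K a b f, fun f => h0 _ _ f,
    fun f => hbase _ _ f⟩
  refine ⟨H.deform, HigherOps.extends_of_ofArrow fun f hf => ?_⟩
  ext x
  exact (H.deform_ofArrow f x).trans (h1 _ _ f hf x)
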